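/- **Definitions.** A *graph operation* is a finite connected oriented multigraph $g$ with $K\ge 0$ ordered edges and two (possibly equal) distinguished vertices, an input and an output; graph operations compose by replacing edges by graph operations (gluing input to source and output to target). A *$\mathcal G$-algebra* is a complex vector space $\mathcal A$ with multilinear maps $Z_g:\mathcal A^K\to\mathcal A$ for all graph operations $g$, compatible with composition, with reordering of the edges and with the identity $(\cdot\leftarrow\cdot)$; it is a unital algebra for $ab=Z_{\cdot\overset1\leftarrow\cdot\overset2\leftarrow\cdot}(a,b)$ and $\mathbb I=Z_{\cdot}$ (one vertex, no edge). A *$\mathcal G$-subalgebra* is a vector subspace stable under all $Z_g$. Write $\Delta(a)=Z_\Delta(a)$ with $\Delta$ the operation with one vertex and one edge, and $a\circ b$ for the Hadamard product (two parallel edges from input to output). A *$\mathcal G^*$-algebra* has in addition an antilinear involution with $Z_g(a_1,\dots,a_K)^*=Z_{g^*}(a_1^*,\dots,a_K^*)$, where $g^*$ is $g$ with its edges reversed and its input and output interchanged; a *$\mathcal G^*$-subalgebra* is a $\mathcal G$-subalgebra stable under $*$. An $n$-graph monomial labelled by a set is a finite connected oriented multigraph with edges labelled by that set and $n$ marked vertices.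 A *space of traffics* $(\mathcal A,\tau)$ is a $\mathcal G^*$-algebra with a linear form $\Phi:\mathcal A\to\mathbb C$ (the associated trace) such that $\Phi(\mathbb I)=1$; $\Phi\circ Z_g=\Phi\circ Z_{\Delta\circ g}$ for every $g$; when the input and the output of $g$ are the same vertex, $\Phi\circ Z_g$ does not depend on that vertex; and, with $\tau(t)=\Phi\big(Z_g(\gamma(e_1),\dots,\gamma(e_K))\big)$ for a $0$-graph monomial $t$ with edges $e_1,\dots,e_K$ and labels $\gamma$ (where $g$ is $t$ with some vertex chosen as both input and output), $\tau[t|t^*]=\sum_{i,j}c_i\overline{c_j}\,\tau[t_i|t_j^*]\ge 0$ for every linear combination $t=\sum_i c_it_i$ of $n$-graph monomials, $n\ge1$. Here $t_j^*$ has reversed edges and adjoint labels, and $t_i|t_j^*$ is obtained by merging the $k$-th marked vertices for all $k$. The injective version $\tau^0$ is defined by $\tau[t]=\sum_\pi\tau^0[t^\pi]$, the sum running over the partitions $\pi$ of the vertex set of $t$, where $t^\pi$ identifies the vertices in a same block. $\mathcal G$-subalgebras $(\mathcal A_j)_{j\in J}$ are *traffic independent* if for every $0$-graph monomial $T$ labelled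 by the disjoint union $\bigsqcup_j\mathcal A_j$ one has $\tau[T]=\sum_\pi\theta(T^\pi)$, where $\theta(T)=\prod_S\tau^0[S]$, the product running over the colored components $S$ of $T$ (the maximal connected subgraphs with at least one edge and with labels in a single $\mathcal A_j$), if the bipartite graph linking the colored components to the vertices that lie in at least two of them is a tree, and $\theta(T)=0$ otherwise ($\theta=1$ on the graph without edges). Unital subalgebras $(\mathcal C_j)_{j\in J}$ of a unital algebra with a linear form $\varphi$ are *free* if $\varphi(a_1\cdots a_n)=0$ whenever $n\ge1$, $a_k\in\mathcal C_{j_k}$, $\varphi(a_k)=0$ for all $k$, and $j_k\ne j_{k+1}$ for $1\le k<n$. **Lemma.** Let $(\mathcal A,\tau)$ be a space of traffics with associated trace $\Phi$ and put $\eta(a)=\Phi(\Delta(a^*)\Delta(a))-|\Phi(a)|^2$ for $a\in\mathcal A$. Then $\eta(a)=\Phi(a^*\circ a)-|\Phi(a)|^2$ for all $a\in\mathcal A$, and: 1. If $\eta(a)=0$ for all $a\in\mathcal A$, then every traffic independent family $(\mathcal A_j)_{j\in J}$ of $\mathcal G$-subalgebras of $\mathcal A$ is free in $(\mathcal A,\Phi)$.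 2. Let $\mathcal B$ be a unital subalgebra of $\mathcal A$ with $\eta(a)=0$ for all $a\in\mathcal B$, and let $(X_j)_{j\in J}$ be subsets of $\mathcal B$. If the $\mathcal G$-subalgebras of $\mathcal A$ generated by the $X_j$ are traffic independent, then the unital algebras generated by the $X_j$ are free in $(\mathcal B,\Phi_{|\mathcal B})$. If $\mathcal B$ is stable under $*$ and the $\mathcal G^*$-subalgebras of $\mathcal A$ generated by the $X_j$ are traffic independent, then the unital $*$-algebras generated by the $X_j$ are free in $(\mathcal B,\Phi_{|\mathcal B})$. -/

import Mathlib

/-! Graph operations, `𝒢`-algebras, spaces of traffics, traffic independence, free independence. -/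

noncomputable section

namespace Traffic

universe u v

/-! ### Finite connected oriented multigraphs -/

/-- A finite, connected (hence nonempty), oriented multigraph whose edges are indexed by `E`.
Loops and multiple edges are allowed; `E` is required to be finite wherever graphs are used. -/
structure ConnGraph (E : Type) where
  V : Type
  finite : Finite V
  nonempty : Nonempty V
  src : E → V
  tgt : E → V
  connected : ∀ x y : V, Relation.EqvGen (fun x y => ∃ e, src e = x ∧ tgt e = y) x y

/-- A graph operation: a finite connected oriented graph whose edges are indexed by `E`, with an
input and an output. For `E = Fin K` this is a graph operation with `K` ordered edges. -/
structure GraphOp (E : Type) extends ConnGraph E where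
  input : V
  output : V

attribute [instance] ConnGraph.finite ConnGraph.nonempty

theorem eqvGen_map {α β : Type*} {r : α → α → Prop} {s : β → β → Prop} (f : α → β)
    (h : ∀ x y, r x y → Relation.EqvGen s (f x) (f y)) {x y : α} (hxy : Relation.EqvGen r x y) :
    Relation.EqvGen s (f x) (f y) := by
  induction hxy with
  | rel x y hr => exact h x y hr
  | refl x => exact .refl _
  | symm x y _ ih => exact .symm _ _ ih
  | trans x y z _ _ ih₁ ih₂ => exact .trans _ _ _ ih₁ ih₂

namespace ConnGraph

/-- The graph `t^π` obtained by identifying the vertices in a same block of `π`. -/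
def quot {E : Type} (G : ConnGraph E) (π : Setoid G.V) : ConnGraph E where
  V := Quotient π
  finite := inferInstance
  nonempty := ⟨Quotient.mk π (Classical.arbitrary _)⟩
  src e := Quotient.mk π (G.src e)
  tgt e := Quotient.mk π (G.tgt e)
  connected x y := by
    induction x using Quotient.inductionOn with | _ x => ?_
    induction y using Quotient.inductionOn with | _ y => ?_
    refine eqvGen_map (Quotient.mk π) ?_ (G.connected x y)
    rintro _ _ ⟨e, rfl, rfl⟩
    exact .rel _ _ ⟨e, rfl, rfl⟩

/-- The graph with all its edges reversed. -/
def reverse {E : Type} (G : ConnGraph E) : ConnGraph E where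
  V := G.V
  finite := G.finite
  nonempty := G.nonempty
  src := G.tgt
  tgt := G.src
  connected x y := by
    refine eqvGen_map id ?_ (G.connected x y)
    rintro _ _ ⟨e, rfl, rfl⟩
    exact .symm _ _ (.rel _ _ ⟨e, rfl, rfl⟩)

/-- Identification used for `merge`: the `i`-th output of the first graph is identified with the
`i`-th output of the second one. -/
def mergeRel {V W : Type} {n : ℕ} (v : Fin n → V) (w : Fin n → W) (x y : V ⊕ W) : Prop :=
  ∃ i, x = Sum.inl (v i) ∧ y = Sum.inr (w i)

/-- Merging the `i`-th marked vertices of two graphs, for all `i`. At least one vertex is marked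
in each graph, so that the result is connected. -/
def merge {E F : Type} {n : ℕ} (G : ConnGraph E) (H : ConnGraph F)
    (v : Fin (n + 1) → G.V) (w : Fin (n + 1) → H.V) : ConnGraph (E ⊕ F) where
  V := Quot (mergeRel v w)
  finite := inferInstance
  nonempty := ⟨Quot.mk _ (Sum.inl (v 0))⟩
  src := Sum.elim (fun e => Quot.mk _ (Sum.inl (G.src e))) (fun f => Quot.mk _ (Sum.inr (H.src f)))
  tgt := Sum.elim (fun e => Quot.mk _ (Sum.inl (G.tgt e))) (fun f => Quot.mk _ (Sum.inr (H.tgt f)))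
  connected := by
    have key : ∀ z : Quot (mergeRel v w), Relation.EqvGen (fun x y => ∃ e : E ⊕ F,
        Sum.elim (fun e => Quot.mk (mergeRel v w) (Sum.inl (G.src e)))
          (fun f => Quot.mk _ (Sum.inr (H.src f))) e = x ∧
        Sum.elim (fun e => Quot.mk (mergeRel v w) (Sum.inl (G.tgt e)))
          (fun f => Quot.mk _ (Sum.inr (H.tgt f))) e = y) z (Quot.mk _ (Sum.inl (v 0))) := by
      intro z
      induction z using Quot.ind with | _ z => ?_
      rcases z with x | y
      · refine eqvGen_map (fun x => Quot.mk (mergeRel v w) (Sum.inl x)) ?_ (G.connected x (v 0))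
        rintro _ _ ⟨e, rfl, rfl⟩
        exact .rel _ _ ⟨Sum.inl e, rfl, rfl⟩
      · have h0 : Quot.mk (mergeRel v w) (Sum.inl (v 0)) = Quot.mk _ (Sum.inr (w 0)) :=
          Quot.sound ⟨0, rfl, rfl⟩
        rw [h0]
        refine eqvGen_map (fun x => Quot.mk (mergeRel v w) (Sum.inr x)) ?_ (H.connected y (w 0))
        rintro _ _ ⟨e, rfl, rfl⟩
        exact .rel _ _ ⟨Sum.inr e, rfl, rfl⟩
    intro x y
    exact .trans _ _ _ (key x) (.symm _ _ (key y))

/-- The graph operation with underlying graph `G` whose input and output are both `x`. -/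
def rooted {E : Type} (G : ConnGraph E) (x : G.V) : GraphOp E where
  toConnGraph := G
  input := x
  output := x

end ConnGraph

/-! ### Composition of graph operations and particular operations -/

namespace GraphOp

/-- Identifications made when each edge `e` of `g` is replaced by `h e`: the input of `h e` is
glued to the source of `e` and its output to the target of `e`. -/
inductive CompRel {E : Type} {F : E → Type} (g : GraphOp E) (h : ∀ e, GraphOp (F e)) :
    g.V ⊕ (Σ e, (h e).V) → g.V ⊕ (Σ e, (h e).V) → Prop
  | input (e : E) : CompRel g h (Sum.inl (g.src e)) (Sum.inr ⟨e, (h e).input⟩)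
  | output (e : E) : CompRel g h (Sum.inl (g.tgt e)) (Sum.inr ⟨e, (h e).output⟩)

/-- The composition `g ∘ (h e)_e`: each edge `e` of `g` is replaced by the operation `h e`. -/
def comp {E : Type} [Finite E] {F : E → Type} (g : GraphOp E) (h : ∀ e, GraphOp (F e)) :
    GraphOp (Σ e, F e) where
  V := Quot (CompRel g h)
  finite := inferInstance
  nonempty := ⟨Quot.mk _ (Sum.inl g.input)⟩
  src f := Quot.mk _ (Sum.inr ⟨f.1, (h f.1).src f.2⟩)
  tgt f := Quot.mk _ (Sum.inr ⟨f.1, (h f.1).tgt f.2⟩)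
  connected := by
    have inner : ∀ (e : E) (x y : (h e).V), Relation.EqvGen (fun x y => ∃ f : Σ e, F e,
        Quot.mk (CompRel g h) (Sum.inr ⟨f.1, (h f.1).src f.2⟩) = x ∧
        Quot.mk (CompRel g h) (Sum.inr ⟨f.1, (h f.1).tgt f.2⟩) = y)
        (Quot.mk _ (Sum.inr ⟨e, x⟩)) (Quot.mk _ (Sum.inr ⟨e, y⟩)) := by
      intro e x y
      refine eqvGen_map (fun x => Quot.mk (CompRel g h) (Sum.inr ⟨e, x⟩)) ?_ ((h e).connected x y)
      rintro _ _ ⟨f, rfl, rfl⟩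
      exact .rel _ _ ⟨⟨e, f⟩, rfl, rfl⟩
    have outer : ∀ x y : g.V, Relation.EqvGen (fun x y => ∃ f : Σ e, F e,
        Quot.mk (CompRel g h) (Sum.inr ⟨f.1, (h f.1).src f.2⟩) = x ∧
        Quot.mk (CompRel g h) (Sum.inr ⟨f.1, (h f.1).tgt f.2⟩) = y)
        (Quot.mk _ (Sum.inl x)) (Quot.mk _ (Sum.inl y)) := by
      intro x y
      refine eqvGen_map (fun x => Quot.mk (CompRel g h) (Sum.inl x)) ?_ (g.connected x y)
      rintro _ _ ⟨e, rfl, rfl⟩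
      rw [Quot.sound (CompRel.input (h := h) e), Quot.sound (CompRel.output (h := h) e)]
      exact inner e _ _
    have key : ∀ z : Quot (CompRel g h), Relation.EqvGen (fun x y => ∃ f : Σ e, F e,
        Quot.mk (CompRel g h) (Sum.inr ⟨f.1, (h f.1).src f.2⟩) = x ∧
        Quot.mk (CompRel g h) (Sum.inr ⟨f.1, (h f.1).tgt f.2⟩) = y)
        z (Quot.mk _ (Sum.inl g.input)) := by
      intro z
      induction z using Quot.ind with | _ z => ?_
      rcases z with x | ⟨e, x⟩
      · exact outer _ _
      · refine .trans _ _ _ (inner e x (h e).input) ?_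
        rw [← Quot.sound (CompRel.input (h := h) e)]
        exact outer _ _
    intro x y
    exact .trans _ _ _ (key x) (.symm _ _ (key y))
  input := Quot.mk _ (Sum.inl g.input)
  output := Quot.mk _ (Sum.inl g.output)

/-- The involution on graph operations: edges are reversed, input and output are interchanged. -/
def adj {E : Type} (g : GraphOp E) : GraphOp E where
  toConnGraph := g.toConnGraph.reverse
  input := g.output
  output := g.input

/-- A pair of bijections (on vertices, on edges) is an isomorphism of graph operations. -/
structure IsIso {E F : Type} (g : GraphOp E) (h : GraphOp F) (φ : g.V ≃ h.V) (ψ : E ≃ F) :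
    Prop where
  src : ∀ e, h.src (ψ e) = φ (g.src e)
  tgt : ∀ e, h.tgt (ψ e) = φ (g.tgt e)
  input : h.input = φ g.input
  output : h.output = φ g.output

/-- Linear graph with `K` edges: the vertices are `0, …, K`, the output is `0`, the input is
`K` and the `i`-th edge goes from `i + 1` to `i`. -/
def path (K : ℕ) : GraphOp (Fin K) where
  V := Fin (K + 1)
  finite := inferInstance
  nonempty := inferInstance
  src i := i.succ
  tgt i := i.castSucc
  connected := by
    have key : ∀ x : Fin (K + 1), Relation.EqvGen
        (fun x y : Fin (K + 1) => ∃ e : Fin K, e.succ = x ∧ e.castSucc = y) x 0 := by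
      intro x
      induction x using Fin.induction with
      | zero => exact .refl _
      | succ i ih => exact .trans _ _ _ (.rel _ _ ⟨i, rfl, rfl⟩) ih
    intro x y
    exact .trans _ _ _ (key x) (.symm _ _ (key y))
  input := Fin.last K
  output := 0

/-- One vertex and no edges. -/
def point : GraphOp (Fin 0) := path 0

/-- The identity operation `· ← ·`: one edge from the input to the output. -/
def ident : GraphOp (Fin 1) := path 1

/-- The product `· ←¹ · ←² ·`: two successive edges from the input to the output, the second
edge starting at the input. -/
def prod : GraphOp (Fin 2) := path 2

/-- The Hadamard product: two vertices and two edges from the input to the output. -/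
def hadamard : GraphOp (Fin 2) where
  V := Bool
  finite := inferInstance
  nonempty := inferInstance
  src _ := true
  tgt _ := false
  connected := by
    have key : ∀ x : Bool, Relation.EqvGen
        (fun x y : Bool => ∃ _ : Fin 2, true = x ∧ false = y) x true := by
      rintro (_ | _)
      · exact .symm _ _ (.rel _ _ ⟨0, rfl, rfl⟩)
      · exact .refl _
    intro x y
    exact .trans _ _ _ (key x) (.symm _ _ (key y))
  input := true
  output := false

/-- The diagonal operation `Δ`: one vertex and one edge. -/
def diag : GraphOp (Fin 1) where
  V := Unit
  finite := inferInstance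
  nonempty := inferInstance
  src _ := ()
  tgt _ := ()
  connected _ _ := .refl _
  input := ()
  output := ()

end GraphOp

/-! ### `𝒢`-algebras -/

/-- A `𝒢`-algebra: a complex vector space with an action of the operad of graph operations.
Graph operations are considered up to isomorphism; since the edges are indexed by arbitrary finite
types, `Z_iso` contains both this invariance and the equivariance under reordering of the edges. -/
class GAlgebra (A : Type u) extends AddCommGroup A, Module ℂ A where
  Z : ∀ {E : Type} [Finite E], GraphOp E → MultilinearMap ℂ (fun _ : E => A) A
  Z_iso : ∀ {E F : Type} [Finite E] [Finite F] (g : GraphOp E) (h : GraphOp F)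
    (φ : g.V ≃ h.V) (ψ : E ≃ F), g.IsIso h φ ψ → ∀ a : F → A, Z h a = Z g (fun e => a (ψ e))
  Z_ident : ∀ a : Fin 1 → A, Z GraphOp.ident a = a 0
  Z_comp : ∀ {E : Type} [Finite E] {F : E → Type} [∀ e, Finite (F e)] (g : GraphOp E)
    (h : ∀ e, GraphOp (F e)) (a : (Σ e, F e) → A),
    Z (g.comp h) a = Z g (fun e => Z (h e) (fun f => a ⟨e, f⟩))


namespace GAlgebra

variable {A : Type u} [GAlgebra A]

/-- Concatenation of two linear graphs. -/
theorem Z_prod_path (c : Fin 2 → ℕ) (a : ∀ e, Fin (c e) → A) (n : ℕ) (hn : n = c 0 + c 1) :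
    Z GraphOp.prod (fun e => Z (GraphOp.path (c e)) (a e)) =
      Z (GraphOp.path n) (fun i : Fin n =>
        if h : (i : ℕ) < c 0 then a 0 ⟨i, h⟩ else a 1 ⟨i - c 0, by omega⟩) := by
  subst hn
  let h : ∀ e : Fin 2, GraphOp (Fin (c e)) := fun e => GraphOp.path (c e)
  let Q := Quot (GraphOp.CompRel GraphOp.prod h)
  let p0 : Fin (c 0 + 1) → Q := fun i => Quot.mk _ (Sum.inr ⟨0, i⟩)
  let p1 : Fin (c 1 + 1) → Q := fun i => Quot.mk _ (Sum.inr ⟨1, i⟩)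
  let q : Fin 3 → Q := fun i => Quot.mk _ (Sum.inl i)
  have g0 : q 0 = p0 0 := Quot.sound (GraphOp.CompRel.output (g := GraphOp.prod) (h := h) 0)
  have g1 : q 1 = p0 (Fin.last _) :=
    Quot.sound (GraphOp.CompRel.input (g := GraphOp.prod) (h := h) 0)
  have g2 : q 1 = p1 0 := Quot.sound (GraphOp.CompRel.output (g := GraphOp.prod) (h := h) 1)
  have g3 : q 2 = p1 (Fin.last _) :=
    Quot.sound (GraphOp.CompRel.input (g := GraphOp.prod) (h := h) 1)
  let f0 : Fin (c 0 + 1) → Fin (c 0 + c 1 + 1) := fun i => ⟨i, by omega⟩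
  let f1 : Fin (c 1 + 1) → Fin (c 0 + c 1 + 1) := fun i => ⟨c 0 + i, by omega⟩
  let fq : Fin 3 → Fin (c 0 + c 1 + 1) := ![f0 0, f1 0, f1 (Fin.last _)]
  let ff : ∀ e : Fin 2, Fin (c e + 1) → Fin (c 0 + c 1 + 1) :=
    Fin.cons f0 (Fin.cons f1 finZeroElim)
  let f : Q → Fin (c 0 + c 1 + 1) := Quot.lift (Sum.elim fq (fun y => ff y.1 y.2)) (by
    rintro _ _ (e | e)
    · match e with
      | 0 => rfl
      | 1 => rfl
    · match e with
      | 0 => rfl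
      | 1 => rfl)
  let s : Fin (c 0 + c 1 + 1) → Q := fun i =>
    if hi : (i : ℕ) ≤ c 0 then p0 ⟨i, by omega⟩ else p1 ⟨i - c 0, by omega⟩
  have s0 : ∀ i, s (f0 i) = p0 i := by
    intro i
    have : (i : ℕ) ≤ c 0 := by omega
    simp [s, f0, this]
  have s1 : ∀ i, s (f1 i) = p1 i := by
    intro i
    rcases Fin.eq_zero_or_eq_succ i with rfl | ⟨k, rfl⟩
    · rw [← g2, g1]
      simp [s, f1, Fin.last]
    · simp [s, f1]
      rfl
  have hq : ∀ x : Fin 3, s (fq x) = q x := by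
    intro x
    match x with
    | 0 => exact (s0 0).trans g0.symm
    | 1 => exact (s1 0).trans g2.symm
    | 2 => exact (s1 _).trans g3.symm
  let φ : Q ≃ Fin (c 0 + c 1 + 1) :=
    { toFun := f
      invFun := s
      left_inv := by
        intro x
        induction x using Quot.ind with | _ x => ?_
        rcases x with x | ⟨e, x⟩
        · exact hq x
        · match e, x with
          | 0, x => exact s0 x
          | 1, x => exact s1 x
      right_inv := by
        intro i
        by_cases hi : (i : ℕ) ≤ c 0
        · simp only [s, hi, dite_true]
          rfl
        · simp only [s, hi, dite_false]
          apply Fin.ext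
          change c 0 + (i - c 0 : ℕ) = i
          omega }
  let ψf : (Σ e : Fin 2, Fin (c e)) → Fin (c 0 + c 1) := fun y =>
    (Fin.cons (fun i : Fin (c 0) => ⟨i, by omega⟩)
      (Fin.cons (fun i : Fin (c 1) => ⟨c 0 + i, by omega⟩) finZeroElim) :
      ∀ e : Fin 2, Fin (c e) → Fin (c 0 + c 1)) y.1 y.2
  let ψg : Fin (c 0 + c 1) → (Σ e : Fin 2, Fin (c e)) := fun i =>
    if hi : (i : ℕ) < c 0 then ⟨0, ⟨i, hi⟩⟩ else ⟨1, ⟨i - c 0, by omega⟩⟩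
  let ψ : (Σ e : Fin 2, Fin (c e)) ≃ Fin (c 0 + c 1) :=
    { toFun := ψf
      invFun := ψg
      left_inv := by
        rintro ⟨e, i⟩
        match e, i with
        | 0, i => simp [ψf, ψg]
        | 1, i => simp [ψf, ψg]
      right_inv := by
        intro i
        by_cases hi : (i : ℕ) < c 0
        · simp [ψf, ψg, hi]
        · simp only [ψf, ψg, hi, dite_false]
          apply Fin.ext
          change c 0 + (i - c 0 : ℕ) = i
          omega }
  have iso : (GraphOp.prod.comp h).IsIso (GraphOp.path (c 0 + c 1)) φ ψ :=
    { src := by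
        rintro ⟨e, i⟩
        match e, i with
        | 0, i => rfl
        | 1, i => rfl
      tgt := by
        rintro ⟨e, i⟩
        match e, i with
        | 0, i => rfl
        | 1, i => rfl
      input := rfl
      output := rfl }
  rw [Z_iso (GraphOp.prod.comp h) (GraphOp.path (c 0 + c 1)) φ ψ iso, Z_comp]
  congr 1
  funext e
  match e with
  | 0 =>
    congr 1
    funext i
    simp [ψ, ψf]
  | 1 =>
    congr 1
    funext i
    simp [ψ, ψf]

instance instMul : Mul A := ⟨fun a b => Z GraphOp.prod ![a, b]⟩

instance instOne : One A := ⟨Z GraphOp.point ![]⟩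

theorem mul_def (a b : A) : a * b = Z GraphOp.prod ![a, b] := rfl

theorem one_def : (1 : A) = Z GraphOp.point ![] := rfl

theorem Z_path_one (a : Fin 1 → A) : Z (GraphOp.path 1) a = a 0 := Z_ident a

protected theorem one_mul (a : A) : 1 * a = a := by
  have := Z_prod_path (A := A) ![0, 1] (Fin.cons ![] (Fin.cons ![a] finZeroElim)) 1 rfl
  rw [Z_path_one] at this
  refine Eq.trans ?_ this
  rw [mul_def]
  congr 1
  funext e
  match e with
  | 0 => rfl
  | 1 => exact (Z_path_one ![a]).symm

protected theorem mul_one (a : A) : a * 1 = a := by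
  have := Z_prod_path (A := A) ![1, 0] (Fin.cons ![a] (Fin.cons ![] finZeroElim)) 1 rfl
  rw [Z_path_one] at this
  refine Eq.trans ?_ this
  rw [mul_def]
  congr 1
  funext e
  match e with
  | 0 => exact (Z_path_one ![a]).symm
  | 1 => rfl

protected theorem mul_assoc (a b c : A) : a * b * c = a * (b * c) := by
  have h₁ := Z_prod_path (A := A) ![2, 1] (Fin.cons ![a, b] (Fin.cons ![c] finZeroElim)) 3 rfl
  have h₂ := Z_prod_path (A := A) ![1, 2] (Fin.cons ![a] (Fin.cons ![b, c] finZeroElim)) 3 rfl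
  have e₁ : a * b * c = Z (GraphOp.path 3) ![a, b, c] := by
    refine Eq.trans ?_ (h₁.trans ?_)
    · rw [mul_def]
      congr 1
      funext e
      match e with
      | 0 => rfl
      | 1 => exact (Z_path_one ![c]).symm
    · congr 1
      funext i
      match i with
      | 0 => rfl
      | 1 => rfl
      | 2 => rfl
  have e₂ : a * (b * c) = Z (GraphOp.path 3) ![a, b, c] := by
    refine Eq.trans ?_ (h₂.trans ?_)
    · rw [mul_def]
      congr 1
      funext e
      match e with
      | 0 => exact (Z_path_one ![a]).symm
      | 1 => rfl
    · congr 1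
      funext i
      match i with
      | 0 => rfl
      | 1 => rfl
      | 2 => rfl
  rw [e₁, e₂]

theorem update_zero {A : Type u} (a b x : A) : Function.update ![a, b] 0 x = ![x, b] := by
  funext i
  match i with
  | 0 => rfl
  | 1 => rfl

theorem update_one {A : Type u} (a b x : A) : Function.update ![a, b] 1 x = ![a, x] := by
  funext i
  match i with
  | 0 => rfl
  | 1 => rfl

protected theorem add_mul (a b c : A) : (a + b) * c = a * c + b * c := by
  have := (Z (A := A) GraphOp.prod).map_update_add ![0, c] 0 a b
  simpa only [update_zero, mul_def] using this

protected theorem mul_add (a b c : A) : a * (b + c) = a * b + a * c := by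
  have := (Z (A := A) GraphOp.prod).map_update_add ![a, 0] 1 b c
  simpa only [update_one, mul_def] using this

protected theorem smul_mul (r : ℂ) (a b : A) : r • a * b = r • (a * b) := by
  have := (Z (A := A) GraphOp.prod).map_update_smul ![0, b] 0 r a
  simpa only [update_zero, mul_def] using this

protected theorem mul_smul_right (r : ℂ) (a b : A) : a * r • b = r • (a * b) := by
  have := (Z (A := A) GraphOp.prod).map_update_smul ![a, 0] 1 r b
  simpa only [update_one, mul_def] using this

/-- The structure of unital associative algebra of a `𝒢`-algebra: the product is the action of
`· ←¹ · ←² ·` and the unit is the action of the graph with one vertex and no edges. -/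
instance instRing : Ring A where
  __ := (inferInstance : AddCommGroup A)
  mul := (· * ·)
  one := 1
  one_mul := GAlgebra.one_mul
  mul_one := GAlgebra.mul_one
  mul_assoc := GAlgebra.mul_assoc
  left_distrib := GAlgebra.mul_add
  right_distrib := GAlgebra.add_mul
  zero_mul a := by
    have := GAlgebra.smul_mul (A := A) 0 0 a
    simpa only [zero_smul] using this
  mul_zero a := by
    have := GAlgebra.mul_smul_right (A := A) 0 a 0
    simpa only [zero_smul] using this

instance instAlgebra : Algebra ℂ A :=
  Algebra.ofModule GAlgebra.smul_mul (fun r x y => GAlgebra.mul_smul_right r x y)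

/-- The diagonal operation `Δ` on a `𝒢`-algebra. -/
def diag (a : A) : A := Z GraphOp.diag ![a]

/-- The Hadamard product on a `𝒢`-algebra. -/
def hadamard (a b : A) : A := Z GraphOp.hadamard ![a, b]

end GAlgebra

/-! ### `𝒢*`-algebras -/

/-- A `𝒢*`-algebra: a `𝒢`-algebra with an antilinear involution such that
`Z_g(a_1, …, a_K)^* = Z_{g^*}(a_1^*, …, a_K^*)`. -/
class GStarAlgebra (A : Type u) extends GAlgebra A, StarAddMonoid A where
  star_smul : ∀ (r : ℂ) (a : A), star (r • a) = starRingEnd ℂ r • star a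
  star_Z : ∀ {E : Type} [Finite E] (g : GraphOp E) (a : E → A),
    star (Z g a) = Z g.adj (fun e => star (a e))

namespace GStarAlgebra

variable {A : Type u} [GStarAlgebra A]

protected theorem star_mul (a b : A) : star (a * b) = star b * star a := by
  have iso : GraphOp.prod.adj.IsIso GraphOp.prod Fin.revPerm Fin.revPerm :=
    { src := by
        intro e
        match e with
        | 0 => rfl
        | 1 => rfl
      tgt := by
        intro e
        match e with
        | 0 => rfl
        | 1 => rfl
      input := rfl
      output := rfl }
  rw [GAlgebra.mul_def, GAlgebra.mul_def, star_Z, GAlgebra.Z_iso _ _ _ _ iso]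
  congr 1
  funext e
  match e with
  | 0 => rfl
  | 1 => rfl

instance instStarRing : StarRing A where
  __ := (inferInstance : StarAddMonoid A)
  star_mul := GStarAlgebra.star_mul

instance instStarModule : StarModule ℂ A := ⟨GStarAlgebra.star_smul⟩

end GStarAlgebra

/-! ### Graph monomials -/

/-- An `n`-graph monomial with labels in `L`: a finite connected oriented graph whose edges are
labelled by `L`, with `n` marked vertices (the outputs). -/
structure GraphMonomial (n : ℕ) (L : Type u) where
  E : Type
  finite : Finite E
  graph : ConnGraph E
  label : E → L
  out : Fin n → graph.V

attribute [instance] GraphMonomial.finite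

namespace GraphMonomial

variable {n : ℕ} {L : Type u} {M : Type v}

/-- Relabelling of the edges. -/
def map (f : L → M) (t : GraphMonomial n L) : GraphMonomial n M where
  E := t.E
  finite := t.finite
  graph := t.graph
  label e := f (t.label e)
  out := t.out

/-- The monomial `t^π` obtained by identifying the vertices in a same block of `π`. -/
def quot (t : GraphMonomial n L) (π : Setoid t.graph.V) : GraphMonomial n L where
  E := t.E
  finite := t.finite
  graph := t.graph.quot π
  label := t.label
  out i := Quotient.mk π (t.out i)

/-- The monomial `t^*`: the edges are reversed and their labels are replaced by the adjoints. -/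
def adj [Star L] (t : GraphMonomial n L) : GraphMonomial n L where
  E := t.E
  finite := t.finite
  graph := t.graph.reverse
  label e := star (t.label e)
  out := t.out

/-- The `0`-graph monomial `t|t'` obtained by merging the `i`-th outputs of `t` and `t'`. -/
def merge (t t' : GraphMonomial (n + 1) L) : GraphMonomial 0 L where
  E := t.E ⊕ t'.E
  finite := inferInstance
  graph := t.graph.merge t'.graph t.out t'.out
  label := Sum.elim t.label t'.label
  out := finZeroElim

end GraphMonomial

/-! ### Spaces of traffics -/

section Traffics

variable {A : Type u}

/-- The distribution of traffics associated with a linear functional `Φ`, on `0`-graph monomials: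
`τ(t) = Φ(Z_g(γ(e_1), …, γ(e_K)))` where `g` is the graph of `t` in which some vertex is chosen
both as input and as output (when `Φ` is input-independent the choice is irrelevant). -/
def trafficDistr [GAlgebra A] (Φ : A →ₗ[ℂ] ℂ) (t : GraphMonomial 0 A) : ℂ :=
  Φ (GAlgebra.Z (t.graph.rooted (Classical.arbitrary _)) t.label)

/-- `(A, Φ)` is an algebraic space of traffics: `Φ` is unital and input-independent, that is
`Φ ∘ Z_g = Φ ∘ Z_{Δ ∘ g}`, and `Φ ∘ Z_g`, when the input and the output of `g` coincide, does not
depend on the vertex at which they are placed. -/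
structure IsAlgebraicTrafficSpace [GAlgebra A] (Φ : A →ₗ[ℂ] ℂ) : Prop where
  map_one : Φ 1 = 1
  map_diag : ∀ {E : Type} [Finite E] (g : GraphOp E) (a : E → A),
    Φ (GAlgebra.Z g a) = Φ (GAlgebra.diag (GAlgebra.Z g a))
  map_rooted : ∀ {E : Type} [Finite E] (G : ConnGraph E) (x y : G.V) (a : E → A),
    Φ (GAlgebra.Z (G.rooted x) a) = Φ (GAlgebra.Z (G.rooted y) a)

open scoped ComplexOrder in
/-- `(A, Φ)` is a space of traffics: an algebraic space of traffics over a `𝒢*`-algebra such that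
`τ[t|t^*] ≥ 0` for every `n`-graph polynomial `t = ∑ᵢ cᵢ tᵢ` with at least one output, where
`t|t^* = ∑ᵢⱼ cᵢ conj(cⱼ) tᵢ|tⱼ^*`. -/
structure IsTrafficSpace [GStarAlgebra A] (Φ : A →ₗ[ℂ] ℂ) : Prop
    extends IsAlgebraicTrafficSpace Φ where
  nonneg : ∀ (n k : ℕ) (c : Fin k → ℂ) (t : Fin k → GraphMonomial (n + 1) A),
    0 ≤ ∑ i, ∑ j, c i * star (c j) * trafficDistr Φ ((t i).merge (t j).adj)

end Traffics

/-! ### Injective version of a functional on graph monomials -/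

section Injective

variable (V : Type) [Finite V]

instance instFiniteSetoid : Finite (Setoid V) :=
  Finite.of_injective (fun s : Setoid V => s.r) (fun _ _ h => Setoid.ext fun x y => by
    exact iff_of_eq (congrFun (congrFun h x) y))

instance instFintypeSetoid : Fintype (Setoid V) := Fintype.ofFinite _

open Classical in
/-- The Möbius function of the lattice of partitions of `V` (ordered so that `⊥` is the partition
into singletons) between the partition into singletons and `π`. -/
def partitionMoebius {V : Type} [Finite V] (π : Setoid V) : ℂ :=
  letI : LocallyFiniteOrder (Setoid V) := Fintype.toLocallyFiniteOrder
  IncidenceAlgebra.mu ℂ ⊥ π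

/-- The injective version `τ⁰` of `τ`, characterized by `τ[t] = ∑_π τ⁰[t^π]`. -/
def injectiveVersion {L : Type u} (τ : GraphMonomial 0 L → ℂ) (t : GraphMonomial 0 L) : ℂ :=
  ∑ π : Setoid t.graph.V, partitionMoebius π * τ (t.quot π)

end Injective

/-! ### Coloured components -/

namespace ConnGraph

variable {E : Type} {J : Type v} (G : ConnGraph E) (c : E → J)

/-- Two edges of the same colour which share a vertex. -/
def Touch (e f : E) : Prop :=
  c e = c f ∧ (G.src e = G.src f ∨ G.src e = G.tgt f ∨ G.tgt e = G.src f ∨ G.tgt e = G.tgt f)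

/-- Two edges are in the same coloured component when they are linked by a chain of edges of the
same colour, two consecutive ones sharing a vertex. -/
def sameComponent : Setoid E := Relation.EqvGen.setoid (G.Touch c)

/-- The coloured components: the maximal connected subgraphs with at least one edge whose edges
have all the same colour, each given by its set of edges. -/
def Component : Type := Quotient (G.sameComponent c)

instance [Finite E] : Finite (G.Component c) := inferInstanceAs (Finite (Quotient _))

/-- The coloured component of an edge. -/
def componentOf (e : E) : G.Component c := Quotient.mk _ e

/-- The vertices of a coloured component. -/
def componentVerts (K : G.Component c) : Set G.V :=
  {x | ∃ e, G.componentOf c e = K ∧ (G.src e = x ∨ G.tgt e = x)}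

/-- A coloured component, as a connected graph. -/
def componentGraph (K : G.Component c) : ConnGraph {e : E // G.componentOf c e = K} where
  V := G.componentVerts c K
  finite := inferInstance
  nonempty := by
    induction K using Quotient.inductionOn with | _ e => ?_
    exact ⟨⟨G.src e, e, rfl, Or.inl rfl⟩⟩
  src e := ⟨G.src e.1, e.1, e.2, Or.inl rfl⟩
  tgt e := ⟨G.tgt e.1, e.1, e.2, Or.inr rfl⟩
  connected := by
    let S : {e : E // G.componentOf c e = K} → G.componentVerts c K :=
      fun e => ⟨G.src e.1, e.1, e.2, Or.inl rfl⟩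
    let T : {e : E // G.componentOf c e = K} → G.componentVerts c K :=
      fun e => ⟨G.tgt e.1, e.1, e.2, Or.inr rfl⟩
    let R := Relation.EqvGen (fun x y => ∃ e, S e = x ∧ T e = y)
    have hST : ∀ e, R (S e) (T e) := fun e => .rel _ _ ⟨e, rfl, rfl⟩
    have hsrc : ∀ e f : E, Relation.EqvGen (G.Touch c) e f →
        ∀ (he : G.componentOf c e = K) (hf : G.componentOf c f = K),
        R (S ⟨e, he⟩) (S ⟨f, hf⟩) := by
      intro e f hef
      induction hef with
      | rel e f h =>
        intro he hf
        rcases h.2 with h | h | h | h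
        · have h' : S ⟨e, he⟩ = S ⟨f, hf⟩ := Subtype.ext h
          rw [h']
          exact .refl _
        · have h' : S ⟨e, he⟩ = T ⟨f, hf⟩ := Subtype.ext h
          rw [h']
          exact .symm _ _ (hST _)
        · have h' : T ⟨e, he⟩ = S ⟨f, hf⟩ := Subtype.ext h
          rw [← h']
          exact hST _
        · have h' : T ⟨e, he⟩ = T ⟨f, hf⟩ := Subtype.ext h
          refine .trans _ _ _ (hST _) ?_
          rw [h']
          exact .symm _ _ (hST _)
      | refl e => intro _ _; exact .refl _
      | symm e f _ ih => intro he hf; exact .symm _ _ (ih hf he)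
      | trans e f g hef _ ih₁ ih₂ =>
        intro he hg
        have hf : G.componentOf c f = K := by
          rw [← he]
          exact (Quotient.sound (s := G.sameComponent c) hef).symm
        exact .trans _ _ _ (ih₁ he hf) (ih₂ hf hg)
    have hv : ∀ x : G.componentVerts c K, ∃ e, R x (S e) := by
      rintro ⟨x, e, he, hx⟩
      refine ⟨⟨e, he⟩, ?_⟩
      rcases hx with hx | hx
      · subst hx
        exact .refl _
      · subst hx
        exact .symm _ _ (hST ⟨e, he⟩)
    intro x y
    obtain ⟨e, he⟩ := hv x
    obtain ⟨f, hf⟩ := hv y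
    refine .trans _ _ _ he (.trans _ _ _ ?_ (.symm _ _ hf))
    exact hsrc e.1 f.1 (Quotient.exact (s := G.sameComponent c) (e.2.trans f.2.symm)) e.2 f.2

/-- The connectors: the vertices which belong to at least two different coloured components. -/
def connectors : Set G.V :=
  {x | ∃ K L : G.Component c, K ≠ L ∧ x ∈ G.componentVerts c K ∧ x ∈ G.componentVerts c L}

/-- The graph of coloured components: its vertices are the coloured components and the connectors,
and a component is linked to the connectors that belong to it. -/
def componentsGraph : SimpleGraph (G.Component c ⊕ G.connectors c) :=
  SimpleGraph.fromRel fun p q =>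
    ∃ (K : G.Component c) (x : G.connectors c),
      p = Sum.inl K ∧ q = Sum.inr x ∧ x.1 ∈ G.componentVerts c K

end ConnGraph

/-! ### Traffic independence -/

section Independence

variable {A : Type u} {J : Type v}

/-- The labels of a `0`-graph monomial in the disjoint union of the `Sⱼ`, seen as elements of `A`. -/
def forgetColour {S : J → Set A} (T : GraphMonomial 0 (Σ j, S j)) : GraphMonomial 0 A :=
  T.map fun x => x.2.1

/-- The colours of the edges of a monomial labelled in a disjoint union. -/
def colour {S : J → Set A} (T : GraphMonomial 0 (Σ j, S j)) (e : T.E) : J := (T.label e).1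

/-- A coloured component of `T`, as a `0`-graph monomial labelled in `A`. -/
def colouredComponent {S : J → Set A} (T : GraphMonomial 0 (Σ j, S j))
    (K : T.graph.Component (colour T)) : GraphMonomial 0 A where
  E := {e : T.E // T.graph.componentOf (colour T) e = K}
  finite := inferInstance
  graph := T.graph.componentGraph (colour T) K
  label e := (T.label e.1).2.1
  out := finZeroElim

open Classical in
/-- The injective version of the free product of the restrictions of `τ` to the sets `Sⱼ`:
`𝟙(the graph of coloured components is a tree) * ∏ τ⁰[coloured components]`, with value one on the
graph with no edge. -/
def freeProductInjective (τ : GraphMonomial 0 A → ℂ) {S : J → Set A}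
    (T : GraphMonomial 0 (Σ j, S j)) : ℂ :=
  letI : Fintype (T.graph.Component (colour T)) := Fintype.ofFinite _
  if IsEmpty T.E ∨ (T.graph.componentsGraph (colour T)).IsTree then
    ∏ K : T.graph.Component (colour T), injectiveVersion τ (colouredComponent T K)
  else 0

/-- The free product of the restrictions of `τ` to the sets `Sⱼ`. -/
def freeProduct (τ : GraphMonomial 0 A → ℂ) {S : J → Set A}
    (T : GraphMonomial 0 (Σ j, S j)) : ℂ :=
  ∑ π : Setoid T.graph.V, freeProductInjective τ (T.quot π)

/-- A `𝒢`-subalgebra: a vector subspace stable by the action of the graph operations. -/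
structure IsGSubalgebra [GAlgebra A] (p : Submodule ℂ A) : Prop where
  Z_mem : ∀ {E : Type} [Finite E] (g : GraphOp E) (a : E → A),
    (∀ e, a e ∈ p) → GAlgebra.Z g a ∈ p

/-- The `𝒢`-subalgebra generated by a set. -/
def gClosure [GAlgebra A] (X : Set A) : Submodule ℂ A :=
  sInf {p | IsGSubalgebra p ∧ X ⊆ p}

/-- The `𝒢*`-subalgebra generated by a set. -/
def gStarClosure [GStarAlgebra A] (X : Set A) : Submodule ℂ A :=
  sInf {p | IsGSubalgebra p ∧ (∀ a ∈ p, star a ∈ p) ∧ X ⊆ p}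

/-- The unital subalgebra underlying a `𝒢`-subalgebra. -/
def IsGSubalgebra.toSubalgebra [GAlgebra A] {p : Submodule ℂ A} (hp : IsGSubalgebra p) :
    Subalgebra ℂ A :=
  Submodule.toSubalgebra p (hp.Z_mem GraphOp.point ![] finZeroElim) fun a b ha hb =>
    hp.Z_mem GraphOp.prod ![a, b] (Fin.cons ha (Fin.cons hb finZeroElim))

/-- Traffic independence of a family of `𝒢`-subalgebras: on monomials labelled in their disjoint
union, the distribution of traffics is the free product of its restrictions. -/
def TrafficIndep [GAlgebra A] (Φ : A →ₗ[ℂ] ℂ) (S : J → Submodule ℂ A) : Prop :=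
  ∀ T : GraphMonomial 0 (Σ j, (S j : Set A)),
    trafficDistr Φ (forgetColour T) = freeProduct (trafficDistr Φ) T

/-- Free independence of a family of unital subalgebras with respect to a linear functional `φ`:
an alternating product of centred elements is centred. -/
def FreeIndep {R : Type u} [Ring R] [Algebra ℂ R] (φ : R →ₗ[ℂ] ℂ) (S : J → Subalgebra ℂ R) :
    Prop :=
  ∀ (n : ℕ) (j : Fin (n + 1) → J) (a : Fin (n + 1) → R),
    (∀ k, a k ∈ S (j k)) → (∀ k, φ (a k) = 0) → (∀ k : Fin n, j k.castSucc ≠ j k.succ) →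
    φ (List.ofFn a).prod = 0

/-- `η(a) = Φ(Δ(a^*) Δ(a)) - |Φ(a)|²`. -/
def eta [GStarAlgebra A] (Φ : A →ₗ[ℂ] ℂ) (a : A) : ℂ :=
  Φ (GAlgebra.diag (star a) * GAlgebra.diag a) - (‖Φ a‖ : ℂ) ^ 2

end Independence

end Traffic

end

/-! The trace of an alternating product `a₁ ⋯ aₙ` of centred elements is the value of `τ` on a cycle
`T` whose successive edges are labelled `a₁, …, aₙ`. Traffic independence expands it as a sum of
`θ(T^π)` over the partitions `π` of the vertices, and every term vanishes, for two reasons.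

Combinatorics (`exists_component_subsingleton_of_closedWalk`): the edges of `T^π` form a closed walk
whose consecutive edges have different colours. Suppose that the graph of coloured components is a
tree. Its leaves are components, since a connector lies in at least two of them. Both ends of an
edge of a leaf component are shared with neighbouring edges of other components, so they are
connectors; a leaf has only one connector, so it consists of loops at a single vertex. The first and
last edges may have the same colour, which is harmless: a tree has two leaves, and one of them is
not the component of the first edge.

Positivity (`trafficDistr_eq_zero_of_subsingleton`): when `Φ(a) = 0` and `η(a) = 0`, the loop
labelled `a` is an isotropic vector of the positive form `τ[t|s^*]`. As in the Cauchy–Schwarz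
inequality, it pairs to zero with any bouquet of loops, so `τ` and `τ⁰` vanish on every one-vertex
graph carrying that loop. The leaf therefore contributes a zero factor to `θ(T^π)`.

Only `η(aₖ) = 0` for the factors themselves is needed, so the versions inside a subalgebra `B`
follow from the same statement, `TrafficIndep.map_prod_eq_zero`. -/

namespace Traffic

universe u v

/-! ### The action of graph operations with one vertex -/

namespace GraphOp

/-- The graph operation with one vertex whose edges are loops indexed by `E`. -/
def bouquet (E : Type) : GraphOp E where
  V := Unit
  finite := inferInstance
  nonempty := inferInstance
  src _ := ()
  tgt _ := ()
  connected _ _ := .refl _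
  input := ()
  output := ()

theorem isIso_bouquet {E F : Type} (g : GraphOp E) (hg : Subsingleton g.V) (ψ : E ≃ F) :
    g.IsIso (bouquet F)
      ⟨fun _ => (), fun _ => g.input, fun _ => Subsingleton.elim _ _, fun _ => rfl⟩ ψ :=
  ⟨fun _ => rfl, fun _ => rfl, rfl, rfl⟩

/-- Each vertex of an inserted operation is its input or its output, hence glued to a vertex of `g`,
and the vertices of `g` are already identified with each other. -/
theorem subsingleton_comp {E : Type} [Finite E] {F : E → Type} (g : GraphOp E)
    (h : ∀ e, GraphOp (F e)) (hg : ∀ x : g.V, Quot.mk (CompRel g h) (Sum.inl x) =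
      Quot.mk (CompRel g h) (Sum.inl g.input))
    (hh : ∀ e, ∀ x : (h e).V, x = (h e).input ∨ x = (h e).output) :
    Subsingleton (g.comp h).V := by
  have key : ∀ z : (g.comp h).V, z = Quot.mk (CompRel g h) (Sum.inl g.input) := by
    intro z
    induction z using Quot.ind with | _ z => ?_
    rcases z with x | ⟨e, x⟩
    · exact hg x
    · rcases hh e x with rfl | rfl
      · exact (Quot.sound (CompRel.input e)).symm.trans (hg _)
      · exact (Quot.sound (CompRel.output e)).symm.trans (hg _)
  exact ⟨fun x y => (key x).trans (key y).symm⟩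

end GraphOp

namespace GAlgebra

variable {A : Type u} [GAlgebra A]

/-- A graph operation with one vertex is determined up to isomorphism by its set of loops, so
nothing else about `g` affects its action. -/
theorem Z_eq_bouquet {E F : Type} [Finite E] [Finite F] (g : GraphOp E) (hg : Subsingleton g.V)
    (ψ : E ≃ F) (a : F → A) : Z g (fun e => a (ψ e)) = Z (GraphOp.bouquet F) a :=
  (Z_iso _ _ _ ψ (GraphOp.isIso_bouquet g hg ψ) a).symm

theorem Z_diag (a : Fin 1 → A) : Z GraphOp.diag a = diag (a 0) :=
  congrArg _ (funext fun e => by rw [Subsingleton.elim e 0]; rfl)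

/-- Both this product and `diag (hadamard a b)` amount to two loops at one vertex; the two
expressions of `η` agree for this reason. -/
theorem diag_mul_diag (a b : A) :
    diag a * diag b = Z (GraphOp.bouquet (Fin 2)) ![a, b] := by
  have h1 := Z_comp (A := A) GraphOp.prod (fun _ => GraphOp.diag) (fun f => ![a, b] f.1)
  have hs : Subsingleton (GraphOp.prod.comp fun _ => GraphOp.diag).V := by
    refine GraphOp.subsingleton_comp _ _ ?_ (fun _ _ => Or.inl rfl)
    -- Inserting `Δ` in place of an edge identifies the two ends of that edge.
    have h : ∀ e : Fin 2,
        Quot.mk (GraphOp.CompRel GraphOp.prod fun _ => GraphOp.diag) (Sum.inl (GraphOp.prod.src e))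
          = Quot.mk _ (Sum.inl (GraphOp.prod.tgt e)) := fun e =>
      (Quot.sound (GraphOp.CompRel.input e)).trans (Quot.sound (GraphOp.CompRel.output e)).symm
    change ∀ x : Fin 3, _
    intro x
    match x with
    | 0 => exact (h 0).symm.trans (h 1).symm
    | 1 => exact (h 1).symm
    | 2 => rfl
  have h2 := Z_eq_bouquet (A := A) _ hs (Equiv.sigmaUnique (Fin 2) fun _ => Fin 1) ![a, b]
  refine Eq.trans ?_ (h1.symm.trans h2)
  rw [mul_def]
  congr 1
  funext e
  rw [Z_diag]
  match e with
  | 0 => rfl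
  | 1 => rfl

theorem diag_hadamard (a b : A) :
    diag (hadamard a b) = Z (GraphOp.bouquet (Fin 2)) ![a, b] := by
  have h1 := Z_comp (A := A) GraphOp.diag (fun _ => GraphOp.hadamard) (fun f => ![a, b] f.2)
  have hs : Subsingleton (GraphOp.diag.comp fun _ => GraphOp.hadamard).V := by
    refine GraphOp.subsingleton_comp _ _ (fun _ => rfl) fun _ x => ?_
    rcases x with _ | _
    · exact Or.inr rfl
    · exact Or.inl rfl
  have h2 := Z_eq_bouquet (A := A) _ hs (Equiv.uniqueSigma fun _ : Fin 1 => Fin 2) ![a, b]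
  have h3 : Z (GraphOp.diag.comp fun _ => GraphOp.hadamard) (fun f => ![a, b] f.2) = _ :=
    (congrArg _ (funext fun ⟨e, f⟩ => by rw [Subsingleton.elim e 0]; rfl)).trans h2
  exact (Z_diag _).symm.trans (h1.symm.trans h3)

/-- The action of a linear graph is the product in the algebra. -/
theorem Z_path_eq_prod : ∀ (n : ℕ) (a : Fin n → A), Z (GraphOp.path n) a = (List.ofFn a).prod
  | 0, a => by
    rw [List.ofFn_zero, List.prod_nil, one_def, Subsingleton.elim a ![]]
    rfl
  | n + 1, a => by
    rw [List.ofFn_succ, List.prod_cons, ← Z_path_eq_prod n, mul_def]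
    have := Z_prod_path (A := A) ![1, n]
      (Fin.cons ![a 0] (Fin.cons (fun i : Fin n => a i.succ) finZeroElim)) (n + 1)
      (Nat.add_comm n 1)
    have h2 : Z (GraphOp.path (n + 1)) a = _ := (congrArg (Z (GraphOp.path (n + 1))) ?_).trans this.symm
    · rw [h2]
      congr 1
      funext e
      match e with
      | 0 => exact Z_path_one ![a 0]
      | 1 => rfl
    · funext i
      rcases Fin.eq_zero_or_eq_succ i with rfl | ⟨k, rfl⟩
      · rfl
      · simp
        rfl

end GAlgebra

/-- The two expressions of `η`. -/
theorem eta_eq_hadamard {A : Type u} [GStarAlgebra A] {Φ : A →ₗ[ℂ] ℂ}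
    (hΦ : IsAlgebraicTrafficSpace Φ) (a : A) :
    eta Φ a = Φ (GAlgebra.hadamard (star a) a) - (‖Φ a‖ : ℂ) ^ 2 := by
  rw [eta, GAlgebra.hadamard, hΦ.map_diag, ← GAlgebra.hadamard, GAlgebra.diag_hadamard,
    GAlgebra.diag_mul_diag]

/-! ### Vanishing on graphs with one vertex -/

/-- The value of a distribution of traffics on a graph with one vertex. -/
theorem trafficDistr_of_subsingleton {A : Type u} [GAlgebra A] (Φ : A →ₗ[ℂ] ℂ)
    (t : GraphMonomial 0 A) (ht : Subsingleton t.graph.V) {F : Type} [Finite F] (ψ : t.E ≃ F)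
    (a : F → A) (h : ∀ e, t.label e = a (ψ e)) :
    trafficDistr Φ t = Φ (GAlgebra.Z (GraphOp.bouquet F) a) := by
  rw [trafficDistr, funext h, GAlgebra.Z_eq_bouquet _ ht ψ a]

namespace GraphMonomial

/-- The monomial with one vertex, marked, and loops labelled by `a`. -/
def bouquet {L : Type u} {E : Type} [Finite E] (a : E → L) : GraphMonomial 1 L where
  E := E
  finite := inferInstance
  graph := (GraphOp.bouquet E).toConnGraph
  label := a
  out _ := ()

theorem subsingleton_merge_adj_bouquet {L : Type u} [Star L] {E F : Type} [Finite E] [Finite F]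
    (a : E → L) (b : F → L) : Subsingleton ((bouquet a).merge (bouquet b).adj).graph.V := by
  refine ⟨fun x y => ?_⟩
  have key : ∀ z : ((bouquet a).merge (bouquet b).adj).graph.V,
      z = Quot.mk _ (Sum.inl ()) := by
    intro z
    induction z using Quot.ind with | _ z => ?_
    rcases z with ⟨⟩ | ⟨⟩
    · rfl
    · exact (Quot.sound ⟨0, rfl, rfl⟩).symm
  exact (key x).trans (key y).symm

end GraphMonomial

theorem trafficDistr_merge_bouquet {A : Type u} [GStarAlgebra A] (Φ : A →ₗ[ℂ] ℂ) {E F : Type}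
    [Finite E] [Finite F] (a : E → A) (b : F → A) :
    trafficDistr Φ ((GraphMonomial.bouquet a).merge (GraphMonomial.bouquet b).adj) =
      Φ (GAlgebra.Z (GraphOp.bouquet (E ⊕ F)) (Sum.elim a fun f => star (b f))) :=
  trafficDistr_of_subsingleton Φ _ (GraphMonomial.subsingleton_merge_adj_bouquet a b)
    (Equiv.refl _) _ fun e => by rcases e with _ | _ <;> rfl

open scoped ComplexOrder in
/-- Off-diagonal coefficients of a positive sesquilinear form vanish on isotropic vectors. -/
theorem sesq_eq_zero_of_isotropic (z w d : ℂ)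
    (h : ∀ c e : ℂ, 0 ≤ c * star e * z + e * star c * w + e * star e * d) : z = 0 := by
  -- With `e = 1`, the value `c = 0` shows that `d` is real; real and purely imaginary values of `c`
  -- then control `z + w` and `z - w`.
  have h0 := Complex.nonneg_iff.1 (h 0 1)
  have h1 := fun s : ℝ => Complex.nonneg_iff.1 (h s 1)
  have h2 := fun s : ℝ => Complex.nonneg_iff.1 (h (s * Complex.I) 1)
  simp at h0 h1 h2
  -- An affine function bounded below is constant: with a nonzero slope, the chosen `s` would give
  -- it the value `-1`.
  have lin : ∀ x y : ℝ, (∀ s : ℝ, 0 ≤ s * x + y) → x = 0 := by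
    intro x y hxy
    by_contra hx
    have := hxy (-(y + 1) / x)
    rw [div_mul_cancel₀ _ hx] at this
    linarith
  have r1 := lin (z.re + w.re) d.re fun s => by have := (h1 s).1; linarith
  have r2 := lin (w.im - z.im) d.re fun s => by have := (h2 s).1; linarith
  have i1 := (h1 1).2
  have i2 := (h2 1).2
  apply Complex.ext <;> simp <;> linarith

/-- A loop with vanishing trace and vanishing `η` at the vertex of a graph with one vertex makes
the distribution of traffics vanish. -/
theorem IsTrafficSpace.trafficDistr_eq_zero_of_subsingleton {A : Type u} [GStarAlgebra A]
    {Φ : A →ₗ[ℂ] ℂ} (hΦ : IsTrafficSpace Φ) (t : GraphMonomial 0 A)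
    (ht : Subsingleton t.graph.V) (f : t.E) (h0 : Φ (t.label f) = 0)
    (hη : eta Φ (t.label f) = 0) : trafficDistr Φ t = 0 := by
  classical
  let t₁ : GraphMonomial 1 A := GraphMonomial.bouquet fun _ : Fin 1 => t.label f
  -- The remaining loops carry adjoint labels because `t₂` enters the merging through `t₂.adj`,
  -- which restores the original labels.
  let t₂ : GraphMonomial 1 A := GraphMonomial.bouquet fun e : {e : t.E // e ≠ f} => star (t.label e)
  -- Since `Φ (t.label f) = 0`, this value is `η` itself, once the two loops are exchanged.
  have h₁₁ : trafficDistr Φ (t₁.merge t₁.adj) = 0 := by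
    have h : GAlgebra.Z (GraphOp.bouquet (Fin 1 ⊕ Fin 1))
        (Sum.elim (fun _ => t.label f) fun _ => star (t.label f)) =
        GAlgebra.Z (GraphOp.bouquet (Fin 2)) ![star (t.label f), t.label f] := by
      rw [← GAlgebra.Z_eq_bouquet (GraphOp.bouquet (Fin 1 ⊕ Fin 1))
        (inferInstanceAs (Subsingleton Unit)) ((Equiv.sumComm _ _).trans finSumFinEquiv)]
      congr 1
      funext e
      rcases e with e | e <;> rw [Subsingleton.elim e 0] <;> rfl
    rw [trafficDistr_merge_bouquet, h, ← GAlgebra.diag_mul_diag]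
    simpa [eta, h0] using hη
  have h₁₂ : trafficDistr Φ (t₁.merge t₂.adj) = trafficDistr Φ t := by
    rw [trafficDistr_merge_bouquet]
    refine (trafficDistr_of_subsingleton Φ t ht ((Equiv.sumCompl (· = f)).symm.trans
      (Equiv.sumCongr (Equiv.ofUnique _ _) (Equiv.refl _))) _ fun e => ?_).symm
    by_cases he : e = f
    · subst he
      simp
    · simp [he]
  rw [← h₁₂]
  refine sesq_eq_zero_of_isotropic _ (trafficDistr Φ (t₂.merge t₁.adj))
    (trafficDistr Φ (t₂.merge t₂.adj)) fun c e => ?_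
  have := hΦ.nonneg 0 2 ![c, e] ![t₁, t₂]
  simpa [Fin.sum_univ_two, h₁₁, add_assoc] using this

/-- Every quotient of a one-vertex graph has one vertex and the same loops, so the Möbius sum
vanishes term by term. -/
theorem IsTrafficSpace.injectiveVersion_eq_zero_of_subsingleton {A : Type u} [GStarAlgebra A]
    {Φ : A →ₗ[ℂ] ℂ} (hΦ : IsTrafficSpace Φ) (t : GraphMonomial 0 A)
    (ht : Subsingleton t.graph.V) (f : t.E) (h0 : Φ (t.label f) = 0)
    (hη : eta Φ (t.label f) = 0) : injectiveVersion (trafficDistr Φ) t = 0 :=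
  Finset.sum_eq_zero fun π _ => by
    rw [hΦ.trafficDistr_eq_zero_of_subsingleton (t.quot π)
      (inferInstanceAs (Subsingleton (Quotient π))) f h0 hη, mul_zero]

/-! ### Coloured components of closed walks -/

namespace ConnGraph

variable {E : Type} {J : Type v} (G : ConnGraph E) (c : E → J)

theorem colour_eq_of_componentOf_eq {e f : E} (h : G.componentOf c e = G.componentOf c f) :
    c e = c f := by
  have h' : Relation.EqvGen (G.Touch c) e f := Quotient.exact (s := G.sameComponent c) h
  clear h
  induction h' with
  | rel _ _ h => exact h.1
  | refl => rfl
  | symm _ _ _ ih => exact ih.symm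
  | trans _ _ _ _ _ ih₁ ih₂ => exact ih₁.trans ih₂

theorem src_mem_componentVerts (e : E) : G.src e ∈ G.componentVerts c (G.componentOf c e) :=
  ⟨e, rfl, Or.inl rfl⟩

theorem tgt_mem_componentVerts (e : E) : G.tgt e ∈ G.componentVerts c (G.componentOf c e) :=
  ⟨e, rfl, Or.inr rfl⟩

theorem componentsGraph_adj {K : G.Component c} {x : G.connectors c}
    (hx : x.1 ∈ G.componentVerts c K) : (G.componentsGraph c).Adj (Sum.inl K) (Sum.inr x) := by
  rw [componentsGraph, SimpleGraph.fromRel_adj]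
  exact ⟨Sum.inl_ne_inr, Or.inl ⟨K, x, rfl, rfl, hx⟩⟩

/-- If the graph of coloured components is a tree with at least two components, at least one
component different from a given one has a single connector. -/
theorem exists_component_ne_subsingleton [Finite E] (hG : (G.componentsGraph c).IsTree)
    {e f : E} (hef : c e ≠ c f) : ∃ K : G.Component c, K ≠ G.componentOf c e ∧
      ∀ x ∈ G.connectors c, x ∈ G.componentVerts c K →
        ∀ y ∈ G.connectors c, y ∈ G.componentVerts c K → x = y := by
  classical
  have : Fintype (G.Component c ⊕ G.connectors c) := Fintype.ofFinite _
  have hne : G.componentOf c e ≠ G.componentOf c f := fun h =>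
    hef (G.colour_eq_of_componentOf_eq c h)
  have : Nontrivial (G.Component c ⊕ G.connectors c) :=
    ⟨Sum.inl (G.componentOf c e), Sum.inl (G.componentOf c f), fun h => hne (Sum.inl.inj h)⟩
  have leaf : ∀ p, (G.componentsGraph c).degree p = 1 → p ≠ Sum.inl (G.componentOf c e) →
      ∃ K : G.Component c, K ≠ G.componentOf c e ∧
        ∀ x ∈ G.connectors c, x ∈ G.componentVerts c K →
          ∀ y ∈ G.connectors c, y ∈ G.componentVerts c K → x = y := by
    intro p hp hpe
    have hp := fun q r =>
      (SimpleGraph.degree_eq_one_iff_existsUnique_adj.1 hp).unique (y₁ := q) (y₂ := r)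
    rcases p with K | ⟨x, K, L, hKL, hK, hL⟩
    · refine ⟨K, fun h => hpe (congrArg _ h), fun x hx hxK y hy hyK => ?_⟩
      have := hp _ _ (G.componentsGraph_adj c (x := ⟨x, hx⟩) hxK)
        (G.componentsGraph_adj c (x := ⟨y, hy⟩) hyK)
      exact congrArg Subtype.val (Sum.inr.inj this)
    -- A connector is linked to two distinct components, so it is not a leaf.
    · refine absurd (Sum.inl.inj (hp (Sum.inl K) (Sum.inl L) ?_ ?_)) hKL
      · exact (G.componentsGraph_adj c hK).symm
      · exact (G.componentsGraph_adj c hL).symm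
  obtain ⟨p, q, hpq, hp, hq⟩ := hG.exists_ne_and_degree_eq_one
  by_cases h : p = Sum.inl (G.componentOf c e)
  · exact leaf q hq fun h' => hpq (h.trans h'.symm)
  · exact leaf p hp h

/-- A graph whose edges form a closed walk along which the colours of consecutive edges differ: if
its graph of coloured components is a tree, some coloured component has a single vertex. -/
theorem exists_component_subsingleton_of_closedWalk [Finite E] (hG : (G.componentsGraph c).IsTree)
    {n : ℕ} (w : Fin (n + 1) ≃ E) (x : Fin (n + 2) → G.V) (hx : x (Fin.last _) = x 0)
    (hs : ∀ i, G.src (w i) = x i.succ) (ht : ∀ i, G.tgt (w i) = x i.castSucc)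
    (hc : ∀ i : Fin n, c (w i.castSucc) ≠ c (w i.succ)) :
    ∃ K : G.Component c, (G.componentVerts c K).Subsingleton := by
  -- A walk with a single edge is a loop and has only one component, so there is no second colour to
  -- provide two leaves; this case is treated directly.
  rcases n with _ | n
  · refine ⟨G.componentOf c (w 0), ?_⟩
    have key : ∀ y ∈ G.componentVerts c (G.componentOf c (w 0)), y = x 0 := by
      rintro y ⟨e, -, he⟩
      obtain ⟨i, rfl⟩ := w.surjective e
      obtain rfl : i = 0 := Fin.fin_one_eq_zero i
      rcases he with rfl | rfl
      · exact (hs 0).trans hx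
      · exact ht 0
    exact fun y hy z hz => (key y hy).trans (key z hz).symm
  -- Avoiding the component of the first edge deals with the closing point of the walk, where the
  -- last and first edges may have the same colour.
  · obtain ⟨K, hK, hconn⟩ := G.exists_component_ne_subsingleton c hG (hc 0)
    refine ⟨K, ?_⟩
    have hcomp : ∀ i : Fin (n + 1),
        G.componentOf c (w i.castSucc) ≠ G.componentOf c (w i.succ) := fun i h =>
      hc i (G.colour_eq_of_componentOf_eq c h)
    have conn_tgt : ∀ i, G.componentOf c (w i) = K → x i.castSucc ∈ G.connectors c := by
      intro i hi
      rcases Fin.eq_zero_or_eq_succ i with rfl | ⟨k, rfl⟩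
      · exact absurd hi.symm hK
      · refine ⟨_, _, hcomp k, ?_, ?_⟩
        · have := G.src_mem_componentVerts c (w k.castSucc)
          rwa [hs] at this
        · have := G.tgt_mem_componentVerts c (w k.succ)
          rwa [ht] at this
    have conn_src : ∀ i, G.componentOf c (w i) = K → x i.succ ∈ G.connectors c := by
      intro i hi
      rcases Fin.eq_castSucc_or_eq_last i with ⟨k, rfl⟩ | rfl
      · refine ⟨_, _, hcomp k, ?_, ?_⟩
        · have := G.src_mem_componentVerts c (w k.castSucc)
          rwa [hs] at this
        · have := G.tgt_mem_componentVerts c (w k.succ)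
          rwa [ht] at this
      -- The source of the last edge is the target of the first one, whose component is not `K`.
      · refine ⟨_, _, hK, ?_, ?_⟩
        · have := G.src_mem_componentVerts c (w (Fin.last _))
          rwa [hs, hi] at this
        · have := G.tgt_mem_componentVerts c (w 0)
          rwa [ht, Fin.castSucc_zero, ← hx] at this
    have key : ∀ y ∈ G.componentVerts c K, y ∈ G.connectors c := by
      rintro y ⟨e, he, hy⟩
      obtain ⟨i, rfl⟩ := w.surjective e
      rcases hy with rfl | rfl
      · rw [hs]
        exact conn_src i he
      · rw [ht]
        exact conn_tgt i he
    exact fun y hy z hz => hconn y (key y hy) hy z (key z hz) hz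

end ConnGraph

/-! ### Alternating products of centred elements -/

variable {A : Type u} {J : Type v} [GStarAlgebra A] {Φ : A →ₗ[ℂ] ℂ}

/-- In the tree case, the one-vertex component contains a centred loop with vanishing `η`, so its
factor `τ⁰` is zero. The vertices `x i` need not be distinct, which allows all the quotients of a
cycle. -/
theorem IsTrafficSpace.freeProductInjective_closedWalk_eq_zero (hΦ : IsTrafficSpace Φ)
    {S : J → Set A} (T : GraphMonomial 0 (Σ j, S j)) {n : ℕ} (w : Fin (n + 1) ≃ T.E)
    (x : Fin (n + 2) → T.graph.V) (hx : x (Fin.last _) = x 0)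
    (hs : ∀ i, T.graph.src (w i) = x i.succ) (ht : ∀ i, T.graph.tgt (w i) = x i.castSucc)
    (hc : ∀ i : Fin n, colour T (w i.castSucc) ≠ colour T (w i.succ))
    (h0 : ∀ e, Φ (T.label e).2.1 = 0) (hη : ∀ e, eta Φ (T.label e).2.1 = 0) :
    freeProductInjective (trafficDistr Φ) T = 0 := by
  rw [freeProductInjective]
  split_ifs with h
  · rcases h with h | h
    · exact h.elim (w 0)
    obtain ⟨K, hK⟩ :=
      T.graph.exists_component_subsingleton_of_closedWalk (colour T) h w x hx hs ht hc
    obtain ⟨e, he⟩ : ∃ e, T.graph.componentOf (colour T) e = K := Quotient.exists_rep K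
    let : Fintype (T.graph.Component (colour T)) := Fintype.ofFinite _
    exact Finset.prod_eq_zero (Finset.mem_univ K)
      (hΦ.injectiveVersion_eq_zero_of_subsingleton (colouredComponent T K)
        ((Set.subsingleton_coe _).2 hK) ⟨e, he⟩ (h0 e) (hη e))
  · rfl

/-- In a traffic independent family, an alternating product of centred elements on which `η`
vanishes is centred. -/
theorem TrafficIndep.map_prod_eq_zero (hΦ : IsTrafficSpace Φ) {S : J → Submodule ℂ A}
    (hS : TrafficIndep Φ S) {n : ℕ} (j : Fin (n + 1) → J) (a : Fin (n + 1) → A)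
    (ha : ∀ k, a k ∈ S (j k)) (h0 : ∀ k, Φ (a k) = 0) (hη : ∀ k, eta Φ (a k) = 0)
    (hj : ∀ k : Fin n, j k.castSucc ≠ j k.succ) : Φ (List.ofFn a).prod = 0 := by
  -- Inserting a path in the loop of `Δ` glues its two ends and produces the cycle; of the `n + 2`
  -- vertices of the path, the first and the last become equal.
  let g := GraphOp.diag.comp fun _ => GraphOp.path (n + 1)
  let x : Fin (n + 2) → g.V := fun i => Quot.mk _ (Sum.inr ⟨0, i⟩)
  have hx : x (Fin.last _) = x 0 :=
    (Quot.sound (GraphOp.CompRel.input (g := GraphOp.diag)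
      (h := fun _ => GraphOp.path (n + 1)) 0)).symm.trans
      (Quot.sound (GraphOp.CompRel.output (g := GraphOp.diag)
        (h := fun _ => GraphOp.path (n + 1)) 0))
  let T : GraphMonomial 0 (Σ j, (S j : Set A)) :=
    { E := Σ _ : Fin 1, Fin (n + 1)
      finite := inferInstance
      graph := g.toConnGraph
      label := fun e => ⟨j e.2, a e.2, ha e.2⟩
      out := finZeroElim }
  let w : Fin (n + 1) ≃ T.E := (Equiv.uniqueSigma fun _ : Fin 1 => Fin (n + 1)).symm
  have hT : Φ (List.ofFn a).prod = trafficDistr Φ (forgetColour T) := by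
    rw [← GAlgebra.Z_path_eq_prod, hΦ.map_diag]
    have h := GAlgebra.Z_comp GraphOp.diag (fun _ => GraphOp.path (n + 1)) fun e => a e.2
    rw [GAlgebra.Z_diag] at h
    rw [← h]
    -- The root of the cycle is moved to the arbitrary vertex used by `trafficDistr`.
    exact hΦ.map_rooted g.toConnGraph g.input _ _
  rw [hT, hS T]
  -- A quotient of the cycle is still a closed walk through the same labelled edges in the same
  -- order.
  exact Finset.sum_eq_zero fun π _ =>
    hΦ.freeProductInjective_closedWalk_eq_zero (T.quot π) w (fun i => Quotient.mk π (x i))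
      (congrArg _ hx) (fun _ => rfl) (fun _ => rfl) hj (fun e => h0 e.2) (fun e => hη e.2)

/-! ### Generated algebras -/

theorem isGSubalgebra_sInf {A : Type u} [GAlgebra A] {C : Set (Submodule ℂ A)}
    (hC : ∀ p ∈ C, IsGSubalgebra p) : IsGSubalgebra (sInf C) :=
  ⟨fun g a ha => Submodule.mem_sInf.2 fun p hp =>
    (hC p hp).Z_mem g a fun e => Submodule.mem_sInf.1 (ha e) p hp⟩

theorem isGSubalgebra_gClosure {A : Type u} [GAlgebra A] (X : Set A) :
    IsGSubalgebra (gClosure X) :=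
  isGSubalgebra_sInf fun _ hp => hp.1

theorem isGSubalgebra_gStarClosure (X : Set A) : IsGSubalgebra (gStarClosure X) :=
  isGSubalgebra_sInf fun _ hp => hp.1

theorem subset_gClosure {A : Type u} [GAlgebra A] (X : Set A) : X ⊆ gClosure X :=
  fun _ ha => Submodule.mem_sInf.2 fun _ hp => hp.2 ha

theorem subset_gStarClosure (X : Set A) : X ⊆ gStarClosure X :=
  fun _ ha => Submodule.mem_sInf.2 fun _ hp => hp.2.2 ha

theorem star_mem_gStarClosure {X : Set A} {a : A} (ha : a ∈ gStarClosure X) :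
    star a ∈ gStarClosure X :=
  Submodule.mem_sInf.2 fun p hp => hp.2.1 a (Submodule.mem_sInf.1 ha p hp)

/-- The product and the unit are graph operations, so a `𝒢`-subalgebra is a unital subalgebra; its
preimage in `B` contains `X`, hence the algebra generated by `X`. -/
theorem coe_mem_gClosure_of_mem_adjoin (B : Subalgebra ℂ A) (X : Set B) {b : B}
    (hb : b ∈ Algebra.adjoin ℂ X) : (b : A) ∈ gClosure (Subtype.val '' X) := by
  have h : Algebra.adjoin ℂ X ≤
      (isGSubalgebra_gClosure (Subtype.val '' X)).toSubalgebra.comap B.val :=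
    Algebra.adjoin_le fun y hy => subset_gClosure _ ⟨y, hy, rfl⟩
  exact h hb

theorem coe_mem_gStarClosure_of_mem_adjoin (B : StarSubalgebra ℂ A) (X : Set B) {b : B}
    (hb : b ∈ StarAlgebra.adjoin ℂ X) : (b : A) ∈ gStarClosure (Subtype.val '' X) := by
  have h : StarAlgebra.adjoin ℂ X ≤ StarSubalgebra.comap B.subtype
      { (isGSubalgebra_gStarClosure (Subtype.val '' X)).toSubalgebra with
        star_mem' := star_mem_gStarClosure } :=
    StarAlgebra.adjoin_le fun y hy => subset_gStarClosure _ ⟨y, hy, rfl⟩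
  exact h hb

end Traffic

/-! ### Freeness of the generated algebras -/

theorem mainTheorem5 {A : Type*} [Traffic.GStarAlgebra A] (Φ : A →ₗ[ℂ] ℂ)
    (hΦ : Traffic.IsTrafficSpace Φ) {J : Type*} :
    -- the two expressions of `η` agree
    (∀ a : A, Traffic.eta Φ a = Φ (Traffic.GAlgebra.hadamard (star a) a) - (‖Φ a‖ : ℂ) ^ 2) ∧
    -- traffic independent `𝒢`-subalgebras are free if `η` vanishes on `A`
    ((∀ a : A, Traffic.eta Φ a = 0) →
      ∀ (S : J → Submodule ℂ A) (hS : ∀ j, Traffic.IsGSubalgebra (S j)),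
        Traffic.TrafficIndep Φ S → Traffic.FreeIndep Φ (fun j => (hS j).toSubalgebra)) ∧
    -- families in a unital subalgebra `B` on which `η` vanishes
    (∀ B : Subalgebra ℂ A, (∀ a ∈ B, Traffic.eta Φ a = 0) →
      ∀ X : J → Set B,
        Traffic.TrafficIndep Φ (fun j => Traffic.gClosure (Subtype.val '' X j)) →
        Traffic.FreeIndep (Φ ∘ₗ B.val.toLinearMap) (fun j => Algebra.adjoin ℂ (X j))) ∧
    -- the same with adjoints, for families in a unital `*`-subalgebra `B`
    (∀ B : StarSubalgebra ℂ A, (∀ a ∈ B, Traffic.eta Φ a = 0) →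
      ∀ X : J → Set B,
        Traffic.TrafficIndep Φ (fun j => Traffic.gStarClosure (Subtype.val '' X j)) →
        Traffic.FreeIndep (Φ ∘ₗ B.subtype.toAlgHom.toLinearMap)
          (fun j => (StarAlgebra.adjoin ℂ (X j)).toSubalgebra)) := by
  refine ⟨Traffic.eta_eq_hadamard hΦ.toIsAlgebraicTrafficSpace, fun hη S hS hind n j a ha h0 hj =>
    hind.map_prod_eq_zero hΦ j a ha h0 (fun k => hη _) hj,
    fun B hη X hind n j a ha h0 hj => ?_, fun B hη X hind n j a ha h0 hj => ?_⟩
  · have := hind.map_prod_eq_zero hΦ j (fun k => (a k : A))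
      (fun k => Traffic.coe_mem_gClosure_of_mem_adjoin B _ (ha k)) h0
      (fun k => hη _ (a k).2) hj
    -- The product is formed in `B`; the inclusion turns it into the product in `A` of the same
    -- elements.
    have e := map_list_prod B.val (List.ofFn a)
    rw [List.map_ofFn] at e
    exact (congrArg Φ e).trans this
  · have := hind.map_prod_eq_zero hΦ j (fun k => (a k : A))
      (fun k => Traffic.coe_mem_gStarClosure_of_mem_adjoin B _ (ha k)) h0
      (fun k => hη _ (a k).2) hj
    have e := map_list_prod B.subtype (List.ofFn a)
    rw [List.map_ofFn] at e
    exact (congrArg Φ e).trans this
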